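/- Let $0<\varepsilon<\pi/2$ and let $a,R,g,\sigma,P_{atm}>0$ and $A\in\mathbb R$ be constants. Let the density $\rho:(0,\infty)\times[0,\varepsilon]\to\mathbb R$, $(r,\theta)\mapsto\rho(r,\theta)$, be continuous with a continuous partial derivative $\rho_\theta$ (one-sided at $\theta=0,\varepsilon$), and let $F:(0,\infty)\to\mathbb R$ be continuous. Put $$s_0(\theta)=\tfrac12\ln\frac{1+\sin\theta}{1-\sin\theta},\qquad H(y,\theta)=\int_0^{s_0(\theta)}g\,\rho_\theta\big(y\cosh s,\arcsin(\tanh s)\big)\,ds,$$ $$\widetilde C(\theta)=A-\int_0^\theta\tan\xi\,F(a\cos\xi)\,d\xi-a\int_0^\theta\sin\xi\,H(a\cos\xi,\xi)\,d\xi .$$ For $\mathcal H\in C^2[0,\varepsilon]$ with $1+\mathcal H>0$ and $\mathcal P\in C[0,\varepsilon]$ let $\mathcal F(\mathcal H,\mathcal P)$ be the function on $[0,\varepsilon]$ given by $$\mathcal F(\mathcal H,\mathcal P)(\theta)=-\frac{g}{P_{atm}}\int_a^{(1+\mathcal H(\theta))R}\rho(\xi,\theta)\,d\xi+\frac1{P_{atm}}\int_{a\cos\theta}^{(1+\mathcal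 H(\theta))R\cos\theta}\Big[\frac{F(y)}y+H(y,\theta)\Big]dy+\frac{\widetilde C(\theta)}{P_{atm}}$$ $$\qquad-\frac{\sigma}{RP_{atm}}\left[\frac{(1+\mathcal H(\theta))^2+2\mathcal H_\theta(\theta)^2}{\big((1+\mathcal H(\theta))^2+\mathcal H_\theta(\theta)^2\big)^{3/2}}-\frac{\mathcal H_{\theta\theta}(\theta)(1+\mathcal H(\theta))^2}{\big((1+\mathcal H(\theta))^2+\mathcal H_\theta(\theta)^2\big)^{3/2}}\right]-\mathcal P(\theta),$$ and let $$\mathcal P_0(\theta)=-\frac{g}{P_{atm}}\int_a^{R}\rho(\xi,\theta)\,d\xi+\frac1{P_{atm}}\int_{a\cos\theta}^{R\cos\theta}\Big[\frac{F(y)}y+H(y,\theta)\Big]dy+\frac{\widetilde C(\theta)}{P_{atm}}-\frac{\sigma}{RP_{atm}}$$ be the surface pressure of the undisturbed surface, so that $\mathcal F(0,\mathcal P_0)=0$. Let $X=\{u\in C^2[0,\varepsilon]:u(0)=0,\ u'(0)=0\}$. Then there is $\delta>0$ such that for every $\mathcal P\in C[0,\varepsilon]$ with $\sup_{\theta\in[0,\varepsilon]}|\mathcal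 P(\theta)-\mathcal P_0(\theta)|<\delta$ there exists $\mathcal H\in X$ with $1+\mathcal H>0$ on $[0,\varepsilon]$ and $\mathcal F(\mathcal H,\mathcal P)=0$ on $[0,\varepsilon]$. -/

import Mathlib

noncomputable section

/-- The data of a stratified azimuthal flow in cylindrical coordinates `(r, θ)`, `θ ∈ [0, ε]`.
No properties are built in: they are hypotheses of the theorem. -/
structure AzimuthalFlow where
  /-- half-width of the angular strip around the Equator -/
  ε : ℝ
  /-- reference radius from which the pressure is integrated -/
  a : ℝ
  /-- radius of the undisturbed free surface -/
  R : ℝ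
  /-- gravitational acceleration -/
  g : ℝ
  /-- coefficient of surface tension -/
  σ : ℝ
  /-- atmospheric pressure -/
  Patm : ℝ
  /-- additive constant in the pressure -/
  A : ℝ
  /-- fluid density `ρ r θ` -/
  ρ : ℝ → ℝ → ℝ
  /-- the free function in the azimuthal velocity -/
  F : ℝ → ℝ

namespace AzimuthalFlow

/-- The angular interval `[0, ε]`. -/
def I (D : AzimuthalFlow) : Set ℝ := Set.Icc 0 D.ε

/-- The partial derivative `ρ_θ(r, θ)`, one-sided at the end points of `[0, ε]`. -/
def rhoTheta (D : AzimuthalFlow) (r θ : ℝ) : ℝ := derivWithin (D.ρ r) D.I θ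

/-- `s₀(θ) = (1/2) ln ((1 + sin θ) / (1 - sin θ))`. -/
def s₀ (θ : ℝ) : ℝ := 1 / 2 * Real.log ((1 + Real.sin θ) / (1 - Real.sin θ))

/-- `θ̃(s) = arcsin (tanh s)`, the angle along a characteristic. -/
def thetaTilde (s : ℝ) : ℝ := Real.arcsin (Real.tanh s)

/-- `H(y, θ) = ∫₀^{s₀(θ)} g ρ_θ(y cosh s, θ̃(s)) ds`. -/
def H (D : AzimuthalFlow) (y θ : ℝ) : ℝ :=
  ∫ s in (0 : ℝ)..s₀ θ, D.g * D.rhoTheta (y * Real.cosh s) (thetaTilde s)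

/-- `C̃(θ) = A - ∫₀^θ tan ξ F(a cos ξ) dξ - a ∫₀^θ sin ξ H(a cos ξ, ξ) dξ`. -/
def CTilde (D : AzimuthalFlow) (θ : ℝ) : ℝ :=
  D.A - (∫ ξ in (0 : ℝ)..θ, Real.tan ξ * D.F (D.a * Real.cos ξ))
    - D.a * ∫ ξ in (0 : ℝ)..θ, Real.sin ξ * D.H (D.a * Real.cos ξ) ξ

/-- The first derivative of a profile on `[0, ε]`, one-sided at the end points. -/
def d1 (D : AzimuthalFlow) (u : ℝ → ℝ) : ℝ → ℝ := derivWithin u D.I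

/-- The second derivative of a profile on `[0, ε]`, one-sided at the end points. -/
def d2 (D : AzimuthalFlow) (u : ℝ → ℝ) : ℝ → ℝ := derivWithin (D.d1 u) D.I

/-- The surface tension expression
`J(u) = ((1+u)² + 2 u_θ²) / ((1+u)² + u_θ²)^{3/2} - u_θθ (1+u)² / ((1+u)² + u_θ²)^{3/2}`. -/
def J (D : AzimuthalFlow) (u : ℝ → ℝ) (θ : ℝ) : ℝ :=
  ((1 + u θ) ^ 2 + 2 * D.d1 u θ ^ 2) / ((1 + u θ) ^ 2 + D.d1 u θ ^ 2) ^ (3 / 2 : ℝ)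
    - D.d2 u θ * (1 + u θ) ^ 2 / ((1 + u θ) ^ 2 + D.d1 u θ ^ 2) ^ (3 / 2 : ℝ)

/-- The functional `𝓕(𝓗, 𝓟)`, as a function of `θ`, of a nondimensional surface profile `u = 𝓗`
(the free surface is `r = (1 + 𝓗(θ)) R`) and a nondimensional surface pressure `P = 𝓟`. -/
def functional (D : AzimuthalFlow) (u P : ℝ → ℝ) (θ : ℝ) : ℝ :=
  -(D.g / D.Patm) * (∫ ξ in D.a..(1 + u θ) * D.R, D.ρ ξ θ)
    + 1 / D.Patm * (∫ y in D.a * Real.cos θ..(1 + u θ) * D.R * Real.cos θ, (D.F y / y + D.H y θ))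
    + D.CTilde θ / D.Patm
    - D.σ / (D.R * D.Patm) * D.J u θ
    - P θ

/-- The surface pressure `𝓟₀` that preserves the undisturbed surface `𝓗 = 0`. -/
def P₀ (D : AzimuthalFlow) (θ : ℝ) : ℝ :=
  -(D.g / D.Patm) * (∫ ξ in D.a..D.R, D.ρ ξ θ)
    + 1 / D.Patm * (∫ y in D.a * Real.cos θ..D.R * Real.cos θ, (D.F y / y + D.H y θ))
    + D.CTilde θ / D.Patm
    - D.σ / (D.R * D.Patm)

/-- `X = {u ∈ C²[0, ε] : u(0) = 0 and u'(0) = 0}` (only the values on `[0, ε]` matter). -/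
def X (D : AzimuthalFlow) : Set (ℝ → ℝ) :=
  {u | ContDiffOn ℝ 2 u D.I ∧ u 0 = 0 ∧ D.d1 u 0 = 0}

end AzimuthalFlow

end

/-!
With the profile `u` and the pressure `P` given, the equation `functional u P = 0` is linear in `u''`.
Solving for `u''` turns it into the initial value problem

  `u'' = φ θ (u, u')`, `u 0 = 0`, `u' 0 = 0`,

so that the theorem is a statement about ordinary differential equations, and no inverse of a
linearized operator is needed. At the origin `φ θ 0 = (P θ - P₀ θ) / c` with `c = σ / (R Patm)`
(`secondDeriv_zero`), hence for `P = P₀` the undisturbed surface `u = 0` is the solution, and for `P`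
near `P₀` the origin is an approximate equilibrium.

The additive term `C̃` and the reference radius `a` cancel against `P₀`
(`functional_eq_pressureGap`); what remains are integrals between `R` and `(1 + u) R` of functions
that are jointly continuous on `(0, ∞) × [0, ε]`. Such integrals are continuous in `θ` and Lipschitz
in `u`, uniformly in `θ` (`continuousOn_pressureGap`, `exists_lipschitz_pressureGap`). The surface
tension expression is smooth in `(u, u')` while `1 + u` stays away from `0`
(`exists_lipschitz_secondDeriv`). So `φ` is Lipschitz on the square `|u|, |u'| ≤ 1/2` with a constant
that does not depend on `P`.

`exists_solution_mem_closedBall_of_small` then gives a solution on the whole of `[0, ε]` that stays in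
this square, as soon as `|P - P₀|` is small: after truncation outside the square the
Picard–Lindelöf theorem has no restriction on the length of the interval, and Grönwall's inequality
keeps the solution away from the truncation. In particular `1 + u ≥ 1/2`.
-/

open Set Metric
open scoped NNReal Topology

/-! ### Solutions of planar systems near an approximate equilibrium -/

/-- The coordinatewise truncation of `ℝ × ℝ` onto the square `[-η, η]²`, which is the closed ball of
radius `η` around `0` for the sup norm. -/
noncomputable def clampSquare {η : ℝ} (hη : -η ≤ η) (x : ℝ × ℝ) : ℝ × ℝ :=
  (projIcc (-η) η hη x.1, projIcc (-η) η hη x.2)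

lemma mem_closedBall_zero_prod {η : ℝ} {x : ℝ × ℝ} :
    x ∈ closedBall (0 : ℝ × ℝ) η ↔ |x.1| ≤ η ∧ |x.2| ≤ η := by
  rw [mem_closedBall_zero_iff, Prod.norm_def, sup_le_iff, Real.norm_eq_abs, Real.norm_eq_abs]

lemma clampSquare_mem {η : ℝ} (hη : -η ≤ η) (x : ℝ × ℝ) :
    clampSquare hη x ∈ closedBall (0 : ℝ × ℝ) η :=
  mem_closedBall_zero_prod.2
    ⟨abs_le.2 (projIcc (-η) η hη x.1).2, abs_le.2 (projIcc (-η) η hη x.2).2⟩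

lemma clampSquare_of_mem {η : ℝ} (hη : -η ≤ η) {x : ℝ × ℝ} (hx : x ∈ closedBall (0 : ℝ × ℝ) η) :
    clampSquare hη x = x := by
  obtain ⟨h1, h2⟩ := mem_closedBall_zero_prod.1 hx
  simp [clampSquare, projIcc_of_mem hη (abs_le.1 h1), projIcc_of_mem hη (abs_le.1 h2)]

lemma lipschitzWith_clampSquare {η : ℝ} (hη : -η ≤ η) : LipschitzWith 1 (clampSquare hη) := by
  have h : LipschitzWith 1 (fun r : ℝ => (projIcc (-η) η hη r : ℝ)) := by
    simpa using! (LipschitzWith.subtype_val _).comp (LipschitzWith.projIcc hη)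
  simpa using! (h.comp LipschitzWith.prod_fst).prodMk (h.comp LipschitzWith.prod_snd)

/-- Existence up to time `T` for small forcing: a vector field that is `K`-Lipschitz on a square
around the origin and at most `δ` at the origin has a solution on all of `[0, T]` that starts at the
origin and stays in the square, where `δ` depends only on `K`, `T` and the square. The field is
truncated outside the square, which makes it bounded and globally Lipschitz, so that the
Picard–Lindelöf theorem reaches time `T`; Grönwall's inequality then shows that the solution never
meets the truncation. -/
theorem exists_solution_mem_closedBall_of_small {T η : ℝ} (hT : 0 ≤ T) (hη : 0 < η) (K : ℝ≥0) :
    ∃ δ : ℝ, 0 < δ ∧ ∀ V : ℝ → ℝ × ℝ → ℝ × ℝ,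
      (∀ t ∈ Icc 0 T, LipschitzOnWith K (V t) (closedBall 0 η)) →
      (∀ x ∈ closedBall (0 : ℝ × ℝ) η, ContinuousOn (V · x) (Icc 0 T)) →
      (∀ t ∈ Icc 0 T, ‖V t 0‖ ≤ δ) →
      ∃ w : ℝ → ℝ × ℝ, w 0 = 0 ∧ ∀ t ∈ Icc 0 T,
        w t ∈ closedBall (0 : ℝ × ℝ) η ∧ HasDerivWithinAt w (V t (w t)) (Icc 0 T) t := by
  obtain ⟨δ, hδ, hδη⟩ : ∃ δ : ℝ, 0 < δ ∧ gronwallBound 0 K δ T < η := by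
    have hlim := (gronwallBound_continuous_ε 0 K T).tendsto 0
    rw [gronwallBound_ε0_δ0] at hlim
    have h := (hlim.eventually (gt_mem_nhds hη)).filter_mono
      (nhdsWithin_le_nhds (s := Ioi (0 : ℝ)))
    obtain ⟨δ, h1, h2⟩ := (h.and self_mem_nhdsWithin).exists
    exact ⟨δ, h2, h1⟩
  refine ⟨δ, hδ, fun V hLip hcont hsmall => ?_⟩
  have hη' : -η ≤ η := by linarith
  have h0 : (0 : ℝ × ℝ) ∈ closedBall (0 : ℝ × ℝ) η := mem_closedBall_self hη.le
  set Vc : ℝ → ℝ × ℝ → ℝ × ℝ := fun t x => V t (clampSquare hη' x) with hVc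
  have hVcLip : ∀ t ∈ Icc 0 T, LipschitzWith K (Vc t) := fun t ht => by
    have h := (hLip t ht).comp (lipschitzWith_clampSquare hη').lipschitzOnWith
      (s := univ) (fun x _ => clampSquare_mem hη' x)
    simpa [lipschitzOnWith_univ] using! h
  have hVc0 : ∀ t ∈ Icc 0 T, ‖Vc t 0‖ ≤ δ := fun t ht => by
    simpa [hVc, clampSquare_of_mem hη' h0] using hsmall t ht
  have hgrow : ∀ t ∈ Icc 0 T, ∀ x, ‖Vc t x‖ ≤ K * ‖x‖ + δ := fun t ht x => by
    have h1 := (hVcLip t ht).dist_le_mul x 0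
    rw [dist_eq_norm, dist_zero_right] at h1
    have h2 := norm_le_norm_sub_add (Vc t x) (Vc t 0)
    linarith [hVc0 t ht]
  have hbound : ∀ t ∈ Icc 0 T, ∀ x, ‖Vc t x‖ ≤ K * η + δ := fun t ht x => by
    have h := hgrow t ht (clampSquare hη' x)
    have h1 : ‖clampSquare hη' x‖ ≤ η := mem_closedBall_zero_iff.1 (clampSquare_mem hη' x)
    have h2 : Vc t (clampSquare hη' x) = Vc t x := by
      simp [hVc, clampSquare_of_mem hη' (clampSquare_mem hη' x)]
    rw [h2] at h
    have := mul_le_mul_of_nonneg_left h1 K.2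
    simp only [NNReal.val_eq_coe] at this
    linarith
  have hL : 0 ≤ K * η + δ := by positivity
  have hPL : IsPicardLindelof Vc (tmin := 0) (tmax := T) ⟨0, left_mem_Icc.2 hT⟩ (0 : ℝ × ℝ)
      (⟨K * η + δ, hL⟩ * ⟨T, hT⟩) 0 ⟨K * η + δ, hL⟩ K :=
    { lipschitzOnWith := fun t ht => (hVcLip t ht).lipschitzOnWith
      continuousOn := fun x _ => hcont _ (clampSquare_mem hη' x)
      norm_le := fun t ht x _ => hbound t ht x
      mul_max_le := by simp only [sub_zero, max_eq_left hT, NNReal.coe_zero]; exact le_rfl }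
  obtain ⟨w, hw0, hw⟩ := hPL.exists_eq_forall_mem_Icc_hasDerivWithinAt₀
  have hwη : ∀ t ∈ Icc 0 T, w t ∈ closedBall (0 : ℝ × ℝ) η := fun t ht => by
    have h := norm_le_gronwallBound_of_norm_deriv_right_le (f := w)
      (f' := fun t => Vc t (w t)) (δ := 0) (K := K) (ε := δ) (a := 0) (b := T)
      (fun s hs => (hw s hs).continuousWithinAt)
      (fun s hs => (hw s (Ico_subset_Icc_self hs)).mono_of_mem_nhdsWithin
        (Icc_mem_nhdsGE_of_mem hs))
      (by simp [show w 0 = 0 from hw0]) (fun s hs => hgrow s (Ico_subset_Icc_self hs) (w s)) t ht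
    rw [mem_closedBall_zero_iff]
    refine h.trans (le_trans ?_ hδη.le)
    exact gronwallBound_mono le_rfl hδ.le K.2 (by linarith [ht.2])
  refine ⟨w, hw0, fun t ht => ⟨hwη t ht, ?_⟩⟩
  have h := hw t ht
  simpa only [hVc, clampSquare_of_mem hη' (hwη t ht)] using h

/-! ### Integrals depending on a parameter -/

/-- An integral between continuously moving end points, of a function that is jointly continuous on
`(0, ∞) × [0, T]`, depends continuously on the parameter. -/
theorem continuousOn_intervalIntegral_param {T : ℝ} (hT : 0 ≤ T) {f : ℝ → ℝ → ℝ} {α β : ℝ → ℝ}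
    (hf : ContinuousOn (fun q : ℝ × ℝ => f q.1 q.2) (Ioi 0 ×ˢ Icc 0 T))
    (hα : ContinuousOn α (Icc 0 T)) (hβ : ContinuousOn β (Icc 0 T))
    (hα0 : ∀ θ ∈ Icc 0 T, 0 < α θ) (hβ0 : ∀ θ ∈ Icc 0 T, 0 < β θ) :
    ContinuousOn (fun θ => ∫ y in α θ..β θ, f y θ) (Icc 0 T) := by
  have hne : (Icc 0 T).Nonempty := nonempty_Icc.2 hT
  -- A common positive lower bound `m` of the end points, below which the integrand is frozen.
  obtain ⟨θα, hθα, hminα⟩ := isCompact_Icc.exists_isMinOn hne hα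
  obtain ⟨θβ, hθβ, hminβ⟩ := isCompact_Icc.exists_isMinOn hne hβ
  set m := min (α θα) (β θβ)
  have hm : 0 < m := lt_min (hα0 _ hθα) (hβ0 _ hθβ)
  rw [continuousOn_iff_continuous_domRestrict]
  have hF : Continuous (Function.uncurry fun (θ : Icc 0 T) (y : ℝ) => f (max m y) θ) :=
    hf.comp_continuous (f := fun p : Icc 0 T × ℝ => (max m p.2, (p.1 : ℝ))) (by fun_prop)
      (fun p => ⟨lt_max_of_lt_left hm, p.1.2⟩)
  have key := (intervalIntegral.continuous_parametric_intervalIntegral_of_continuous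
      (μ := MeasureTheory.volume) (a₀ := 0) hF hβ.domRestrict).sub
    (intervalIntegral.continuous_parametric_intervalIntegral_of_continuous
      (μ := MeasureTheory.volume) (a₀ := 0) hF hα.domRestrict)
  refine key.congr fun θ => ?_
  have hint : ∀ b c : ℝ, IntervalIntegrable (fun y => f (max m y) θ) MeasureTheory.volume b c :=
    fun b c => (hF.comp (Continuous.prodMk_right θ)).intervalIntegrable b c
  simp only [Pi.sub_apply, domRestrict_apply]
  rw [intervalIntegral.integral_interval_sub_left (hint _ _) (hint _ _)]
  refine intervalIntegral.integral_congr fun y hy => ?_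
  have hmy : m ≤ y := le_trans (le_min
    ((min_le_left _ _).trans (hminα θ.2)) ((min_le_right _ _).trans (hminβ θ.2))) hy.1
  simp only [max_eq_right hmy]

/-- Uniform Lipschitz dependence of an integral on its upper end point. -/
theorem exists_bound_intervalIntegral {T m M : ℝ} {f : ℝ → ℝ → ℝ}
    (hm : 0 < m) (hf : ContinuousOn (fun q : ℝ × ℝ => f q.1 q.2) (Ioi 0 ×ˢ Icc 0 T)) :
    ∃ B : ℝ, 0 ≤ B ∧ ∀ θ ∈ Icc 0 T, ∀ x ∈ Icc m M, ∀ y ∈ Icc m M,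
      |∫ ξ in x..y, f ξ θ| ≤ B * |y - x| := by
  obtain ⟨B, hB⟩ := (isCompact_Icc.prod isCompact_Icc).exists_bound_of_continuousOn
    (hf.mono (prod_mono (fun x hx => hm.trans_le hx.1) Subset.rfl :
      Icc m M ×ˢ Icc 0 T ⊆ Ioi 0 ×ˢ Icc 0 T))
  refine ⟨max B 0, le_max_right _ _, fun θ hθ x hx y hy => ?_⟩
  rw [← Real.norm_eq_abs]
  refine intervalIntegral.norm_integral_le_of_norm_le_const fun ξ hξ => ?_
  have hξ' : ξ ∈ Icc m M := uIcc_subset_Icc hx hy (uIoc_subset_uIcc hξ)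
  exact (hB (ξ, θ) ⟨hξ', hθ⟩).trans (le_max_left _ _)

/-! ### Continuity of the pressure terms -/

lemma continuous_real_tanh : Continuous Real.tanh := by
  simp only [funext Real.tanh_eq_sinh_div_cosh]
  exact Real.continuous_sinh.div Real.continuous_cosh fun x => (Real.cosh_pos x).ne'

namespace AzimuthalFlow

lemma sin_mem_Ioo {ε θ : ℝ} (hε : ε < Real.pi / 2) (hθ : θ ∈ Icc 0 ε) :
    Real.sin θ ∈ Ioo (-1) 1 := by
  have h0 : 0 ≤ Real.sin θ :=
    Real.sin_nonneg_of_nonneg_of_le_pi hθ.1 (by linarith [hθ.2, Real.pi_pos])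
  have h1 := Real.sin_lt_sin_of_lt_of_le_pi_div_two (by linarith [hθ.1, Real.pi_pos]) le_rfl
    (hθ.2.trans_lt hε)
  rw [Real.sin_pi_div_two] at h1
  exact ⟨by linarith, h1⟩

lemma s₀_eq_artanh {ε θ : ℝ} (hε : ε < Real.pi / 2) (hθ : θ ∈ Icc 0 ε) :
    s₀ θ = Real.artanh (Real.sin θ) :=
  (Real.artanh_eq_half_log (Ioo_subset_Icc_self (sin_mem_Ioo hε hθ))).symm

lemma continuousOn_s₀ {ε : ℝ} (hε : ε < Real.pi / 2) : ContinuousOn s₀ (Icc 0 ε) := by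
  have h : ∀ θ ∈ Icc 0 ε, 1 - Real.sin θ ≠ 0 := fun θ hθ => by
    linarith [(sin_mem_Ioo hε hθ).2]
  refine continuousOn_const.mul (ContinuousOn.log (ContinuousOn.div (by fun_prop) (by fun_prop) h)
    fun θ hθ => ?_)
  have := sin_mem_Ioo hε hθ
  exact (div_pos (by linarith [this.1]) (by linarith [this.2])).ne'

/-- Along the characteristic that ends at the angle `θ`, the angle runs through `[0, θ]` only. -/
lemma thetaTilde_mem {ε θ s : ℝ} (hε : ε < Real.pi / 2) (hθ : θ ∈ Icc 0 ε)
    (hs : s ∈ uIcc 0 (s₀ θ)) : thetaTilde s ∈ Icc 0 ε := by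
  have hsin := sin_mem_Ioo hε hθ
  have hsin0 : 0 ≤ Real.sin θ :=
    Real.sin_nonneg_of_nonneg_of_le_pi hθ.1 (by linarith [hθ.2, Real.pi_pos])
  rw [s₀_eq_artanh hε hθ, uIcc_of_le (Real.artanh_nonneg hsin0), ← Real.artanh_tanh s] at hs
  have hmem : Real.tanh s ∈ Ioo (-1) 1 := ⟨Real.neg_one_lt_tanh s, Real.tanh_lt_one s⟩
  have h1 := (Real.artanh_le_artanh_iff hmem hsin).1 hs.2
  have h0 : 0 ≤ Real.tanh s := by
    rw [← Real.artanh_zero] at hs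
    exact (Real.artanh_le_artanh_iff (by norm_num) hmem).1 hs.1
  refine ⟨Real.arcsin_nonneg.2 h0, (Real.arcsin_le_arcsin h1).trans ?_⟩
  rw [Real.arcsin_sin (by linarith [hθ.1, Real.pi_pos]) (by linarith [hθ.2])]
  exact hθ.2

/-- `H` is continuous on `(0, ∞) × [0, ε]`. -/
lemma continuousOn_H (D : AzimuthalFlow) (hε₀ : 0 < D.ε) (hε₁ : D.ε < Real.pi / 2)
    (hρθ : ContinuousOn (fun q : ℝ × ℝ => D.rhoTheta q.1 q.2) (Ioi 0 ×ˢ D.I)) :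
    ContinuousOn (fun q : ℝ × ℝ => D.H q.1 q.2) (Ioi 0 ×ˢ D.I) := by
  rw [continuousOn_iff_continuous_domRestrict]
  have htilde : Continuous thetaTilde := Real.continuous_arcsin.comp continuous_real_tanh
  have hf : Continuous (Function.uncurry fun (q : ↥(Ioi (0 : ℝ) ×ˢ D.I)) (s : ℝ) =>
      D.g * D.rhoTheta (q.1.1 * Real.cosh s) (projIcc 0 D.ε hε₀.le (thetaTilde s))) := by
    refine continuous_const.mul (hρθ.comp_continuous (f := fun p : ↥(Ioi (0 : ℝ) ×ˢ D.I) × ℝ =>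
      (p.1.1.1 * Real.cosh p.2, (projIcc 0 D.ε hε₀.le (thetaTilde p.2) : ℝ))) ?_ ?_)
    · have := Real.continuous_cosh
      exact (by fun_prop : Continuous fun p : ↥(Ioi (0 : ℝ) ×ˢ D.I) × ℝ =>
        p.1.1.1 * Real.cosh p.2).prodMk (continuous_subtype_val.comp
          (continuous_projIcc.comp (htilde.comp continuous_snd)))
    · exact fun p => ⟨mul_pos p.1.2.1 (Real.cosh_pos _), (projIcc 0 D.ε hε₀.le _).2⟩
  have hs : Continuous fun q : ↥(Ioi (0 : ℝ) ×ˢ D.I) => s₀ q.1.2 :=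
    (continuousOn_s₀ hε₁).comp_continuous (by fun_prop) fun q => q.2.2
  refine (intervalIntegral.continuous_parametric_intervalIntegral_of_continuous
    (μ := MeasureTheory.volume) (a₀ := 0) hf hs).congr fun q => ?_
  refine intervalIntegral.integral_congr fun s hs => ?_
  simp only [projIcc_of_mem hε₀.le (thetaTilde_mem hε₁ q.2.2 hs)]

lemma continuousOn_pressure_integrand (D : AzimuthalFlow) (hε₀ : 0 < D.ε)
    (hε₁ : D.ε < Real.pi / 2)
    (hρθ : ContinuousOn (fun q : ℝ × ℝ => D.rhoTheta q.1 q.2) (Ioi 0 ×ˢ D.I))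
    (hF : ContinuousOn D.F (Ioi 0)) :
    ContinuousOn (fun q : ℝ × ℝ => D.F q.1 / q.1 + D.H q.1 q.2) (Ioi 0 ×ˢ D.I) := by
  refine ContinuousOn.add (ContinuousOn.div ?_ continuousOn_fst fun q hq => ne_of_gt hq.1)
    (D.continuousOn_H hε₀ hε₁ hρθ)
  exact hF.comp continuousOn_fst fun q hq => hq.1

lemma intervalIntegrable_of_continuousOn_prod {I : Set ℝ} {f : ℝ → ℝ → ℝ}
    (hf : ContinuousOn (fun q : ℝ × ℝ => f q.1 q.2) (Ioi 0 ×ˢ I)) {θ : ℝ} (hθ : θ ∈ I) {b c : ℝ}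
    (hb : 0 < b) (hc : 0 < c) :
    IntervalIntegrable (fun y => f y θ) MeasureTheory.volume b c :=
  ContinuousOn.intervalIntegrable <| hf.comp (f := fun y : ℝ => (y, θ)) (by fun_prop)
    fun _ hy => ⟨(lt_min hb hc).trans_le hy.1, hθ⟩

lemma cos_pos_of_mem {D : AzimuthalFlow} (hε₁ : D.ε < Real.pi / 2) {θ : ℝ} (hθ : θ ∈ D.I) :
    0 < Real.cos θ :=
  Real.cos_pos_of_mem_Ioo ⟨by linarith [hθ.1, Real.pi_pos], hθ.2.trans_lt hε₁⟩

/-- The change of the nondimensional pressure, relative to the undisturbed surface `r = R`, at the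
surface point `r = (1 + x) R` in the direction `θ`. -/
noncomputable def pressureGap (D : AzimuthalFlow) (θ x : ℝ) : ℝ :=
  -(D.g / D.Patm) * (∫ ξ in D.R..(1 + x) * D.R, D.ρ ξ θ)
    + 1 / D.Patm * (∫ y in D.R * Real.cos θ..(1 + x) * D.R * Real.cos θ, (D.F y / y + D.H y θ))

/-- The reference radius `a` and the additive term `C̃` enter only through `P₀`. -/
lemma functional_eq_pressureGap (D : AzimuthalFlow) (hε₀ : 0 < D.ε) (hε₁ : D.ε < Real.pi / 2)
    (ha : 0 < D.a) (hR : 0 < D.R)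
    (hρ : ContinuousOn (fun q : ℝ × ℝ => D.ρ q.1 q.2) (Ioi 0 ×ˢ D.I))
    (hρθ : ContinuousOn (fun q : ℝ × ℝ => D.rhoTheta q.1 q.2) (Ioi 0 ×ˢ D.I))
    (hF : ContinuousOn D.F (Ioi 0)) (u P : ℝ → ℝ) {θ : ℝ} (hθ : θ ∈ D.I) (hu : 0 < 1 + u θ) :
    D.functional u P θ = D.pressureGap θ (u θ) - D.σ / (D.R * D.Patm) * (D.J u θ - 1)
      - (P θ - D.P₀ θ) := by
  have hcos := cos_pos_of_mem hε₁ hθ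
  have huR : 0 < (1 + u θ) * D.R := mul_pos hu hR
  have h1 := intervalIntegral.integral_add_adjacent_intervals
    (intervalIntegrable_of_continuousOn_prod hρ hθ ha hR)
    (intervalIntegrable_of_continuousOn_prod hρ hθ hR huR)
  have hq {b c : ℝ} (hb : 0 < b) (hc : 0 < c) :=
    intervalIntegrable_of_continuousOn_prod (f := fun y θ => D.F y / y + D.H y θ)
      (D.continuousOn_pressure_integrand hε₀ hε₁ hρθ hF) hθ hb hc
  have h2 := intervalIntegral.integral_add_adjacent_intervals
    (hq (mul_pos ha hcos) (mul_pos hR hcos)) (hq (mul_pos hR hcos) (mul_pos huR hcos))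
  rw [functional, P₀, pressureGap, ← h1, ← h2]
  ring

lemma continuousOn_pressureGap (D : AzimuthalFlow) (hε₀ : 0 < D.ε) (hε₁ : D.ε < Real.pi / 2)
    (hR : 0 < D.R)
    (hρ : ContinuousOn (fun q : ℝ × ℝ => D.ρ q.1 q.2) (Ioi 0 ×ˢ D.I))
    (hρθ : ContinuousOn (fun q : ℝ × ℝ => D.rhoTheta q.1 q.2) (Ioi 0 ×ˢ D.I))
    (hF : ContinuousOn D.F (Ioi 0)) {x : ℝ} (hx : 0 < 1 + x) :
    ContinuousOn (fun θ => D.pressureGap θ x) D.I := by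
  refine ContinuousOn.add (continuousOn_const.mul ?_) (continuousOn_const.mul ?_)
  · exact continuousOn_intervalIntegral_param hε₀.le hρ continuousOn_const continuousOn_const
      (fun _ _ => hR) (fun _ _ => mul_pos hx hR)
  · exact continuousOn_intervalIntegral_param (f := fun y θ => D.F y / y + D.H y θ) hε₀.le
      (D.continuousOn_pressure_integrand hε₀ hε₁ hρθ hF) (by fun_prop) (by fun_prop)
      (fun θ hθ => mul_pos hR (cos_pos_of_mem hε₁ hθ))
      (fun θ hθ => mul_pos (mul_pos hx hR) (cos_pos_of_mem hε₁ hθ))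

lemma pressureGap_zero (D : AzimuthalFlow) (θ : ℝ) : D.pressureGap θ 0 = 0 := by
  simp [pressureGap]

/-- The pressure gap is Lipschitz in the surface height, uniformly in the angle. -/
lemma exists_lipschitz_pressureGap (D : AzimuthalFlow) (hε₀ : 0 < D.ε) (hε₁ : D.ε < Real.pi / 2)
    (hR : 0 < D.R)
    (hρ : ContinuousOn (fun q : ℝ × ℝ => D.ρ q.1 q.2) (Ioi 0 ×ˢ D.I))
    (hρθ : ContinuousOn (fun q : ℝ × ℝ => D.rhoTheta q.1 q.2) (Ioi 0 ×ˢ D.I))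
    (hF : ContinuousOn D.F (Ioi 0)) {η : ℝ} (hη : η < 1) :
    ∃ B : ℝ, 0 ≤ B ∧ ∀ θ ∈ D.I, ∀ x ∈ Icc (-η) η, ∀ y ∈ Icc (-η) η,
      |D.pressureGap θ x - D.pressureGap θ y| ≤ B * |x - y| := by
  set m := (1 - η) * D.R * Real.cos D.ε
  set M := (1 + η) * D.R
  have hcosε : 0 < Real.cos D.ε := cos_pos_of_mem hε₁ ⟨hε₀.le, le_rfl⟩
  have h1η : 0 < 1 - η := by linarith
  have hm : 0 < m := mul_pos (mul_pos h1η hR) hcosε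
  have hQ := D.continuousOn_pressure_integrand hε₀ hε₁ hρθ hF
  obtain ⟨B₁, hB₁, h₁⟩ := exists_bound_intervalIntegral (M := M) hm hρ
  obtain ⟨B₂, hB₂, h₂⟩ :=
    exists_bound_intervalIntegral (M := M) (f := fun y θ => D.F y / y + D.H y θ) hm hQ
  refine ⟨|D.g / D.Patm| * (B₁ * D.R) + |1 / D.Patm| * (B₂ * D.R), by positivity,
    fun θ hθ x hx y hy => ?_⟩
  have hcos := cos_pos_of_mem hε₁ hθ
  have hcos1 := Real.cos_le_one θ
  have hcosle : Real.cos D.ε ≤ Real.cos θ :=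
    Real.cos_le_cos_of_nonneg_of_le_pi hθ.1 (by linarith [Real.pi_pos]) hθ.2
  have hpos : ∀ z ∈ Icc (-η) η, 0 < (1 + z) * D.R := fun z hz =>
    mul_pos (by linarith [hz.1]) hR
  have hmem : ∀ z ∈ Icc (-η) η, ∀ k : ℝ, Real.cos D.ε ≤ k → k ≤ 1 →
      (1 + z) * D.R * k ∈ Icc m M := fun z hz k hk hk1 => by
    have h1 : (1 - η) * D.R ≤ (1 + z) * D.R :=
      mul_le_mul_of_nonneg_right (by linarith [hz.1]) hR.le
    have h2 : (1 + z) * D.R ≤ (1 + η) * D.R :=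
      mul_le_mul_of_nonneg_right (by linarith [hz.2]) hR.le
    exact ⟨mul_le_mul h1 hk hcosε.le (hpos z hz).le,
      (mul_le_of_le_one_right (hpos z hz).le hk1).trans h2⟩
  have hmem1 : ∀ z ∈ Icc (-η) η, (1 + z) * D.R ∈ Icc m M := fun z hz => by
    simpa using hmem z hz 1 (Real.cos_le_one _) le_rfl
  have e₁ := intervalIntegral.integral_interval_sub_left
    (intervalIntegrable_of_continuousOn_prod hρ hθ hR (hpos x hx))
    (intervalIntegrable_of_continuousOn_prod hρ hθ hR (hpos y hy))
  have hq {c : ℝ} (hc : 0 < c) :=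
    intervalIntegrable_of_continuousOn_prod (f := fun y θ => D.F y / y + D.H y θ) hQ hθ
      (mul_pos hR hcos) hc
  have e₂ := intervalIntegral.integral_interval_sub_left
    (hq (mul_pos (hpos x hx) hcos)) (hq (mul_pos (hpos y hy) hcos))
  have hsplit : D.pressureGap θ x - D.pressureGap θ y =
      -(D.g / D.Patm) * (∫ ξ in (1 + y) * D.R..(1 + x) * D.R, D.ρ ξ θ)
      + 1 / D.Patm * (∫ z in (1 + y) * D.R * Real.cos θ..(1 + x) * D.R * Real.cos θ,
        (D.F z / z + D.H z θ)) := by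
    rw [pressureGap, pressureGap, ← e₁, ← e₂]
    ring
  have b₁ := h₁ θ hθ _ (hmem1 y hy) _ (hmem1 x hx)
  have b₂ := h₂ θ hθ _ (hmem y hy _ hcosle hcos1) _ (hmem x hx _ hcosle hcos1)
  rw [show (1 + x) * D.R - (1 + y) * D.R = D.R * (x - y) by ring, abs_mul, abs_of_pos hR] at b₁
  rw [show (1 + x) * D.R * Real.cos θ - (1 + y) * D.R * Real.cos θ
    = D.R * Real.cos θ * (x - y) by ring, abs_mul, abs_of_pos (mul_pos hR hcos)] at b₂
  have hRcos : D.R * Real.cos θ ≤ D.R := mul_le_of_le_one_right hR.le hcos1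
  replace b₂ := b₂.trans (mul_le_mul_of_nonneg_left (mul_le_mul_of_nonneg_right
    hRcos (abs_nonneg (x - y))) hB₂)
  rw [hsplit]
  refine (abs_add_le _ _).trans ?_
  rw [abs_mul, abs_mul, abs_neg]
  have c₁ := mul_le_mul_of_nonneg_left b₁ (abs_nonneg (D.g / D.Patm))
  have c₂ := mul_le_mul_of_nonneg_left b₂ (abs_nonneg (1 / D.Patm))
  linarith

lemma continuousOn_P₀ (D : AzimuthalFlow) (hε₀ : 0 < D.ε) (hε₁ : D.ε < Real.pi / 2)
    (ha : 0 < D.a) (hR : 0 < D.R)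
    (hρ : ContinuousOn (fun q : ℝ × ℝ => D.ρ q.1 q.2) (Ioi 0 ×ˢ D.I))
    (hρθ : ContinuousOn (fun q : ℝ × ℝ => D.rhoTheta q.1 q.2) (Ioi 0 ×ˢ D.I))
    (hF : ContinuousOn D.F (Ioi 0)) : ContinuousOn D.P₀ D.I := by
  have hcos : ∀ θ ∈ D.I, 0 < Real.cos θ := fun θ hθ => cos_pos_of_mem hε₁ hθ
  have hprim : ∀ f : ℝ → ℝ, ContinuousOn f D.I →
      ContinuousOn (fun θ => ∫ ξ in (0 : ℝ)..θ, f ξ) D.I := fun f hf => by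
    have h := intervalIntegral.continuousOn_primitive_interval (μ := MeasureTheory.volume)
      (f := f) (a := 0) (b := D.ε) (by
        rw [uIcc_of_le hε₀.le]
        exact hf.integrableOn_compact isCompact_Icc)
    rwa [uIcc_of_le hε₀.le] at h
  have hC : ContinuousOn D.CTilde D.I := by
    refine (continuousOn_const.sub (hprim _ ?_)).sub (continuousOn_const.mul (hprim _ ?_))
    · refine ContinuousOn.mul ?_ (hF.comp (by fun_prop) fun θ hθ => mul_pos ha (hcos θ hθ))
      exact Real.continuousOn_tan.mono fun θ hθ => (hcos θ hθ).ne'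
    · exact ContinuousOn.mul (by fun_prop) ((D.continuousOn_H hε₀ hε₁ hρθ).comp
        (f := fun θ => (D.a * Real.cos θ, θ)) (by fun_prop)
        fun θ hθ => ⟨mul_pos ha (hcos θ hθ), hθ⟩)
  refine (((continuousOn_const.mul ?_).add (continuousOn_const.mul ?_)).add
    (hC.div_const _)).sub continuousOn_const
  · exact continuousOn_intervalIntegral_param hε₀.le hρ continuousOn_const continuousOn_const
      (fun _ _ => ha) (fun _ _ => hR)
  · exact continuousOn_intervalIntegral_param (f := fun y θ => D.F y / y + D.H y θ) hε₀.le
      (D.continuousOn_pressure_integrand hε₀ hε₁ hρθ hF) (by fun_prop) (by fun_prop)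
      (fun θ hθ => mul_pos ha (hcos θ hθ)) (fun θ hθ => mul_pos hR (hcos θ hθ))

/-! ### The surface equation as a second-order initial value problem -/

/-- The right-hand side `φ` of the equation `u'' = φ (u, u')` that prescribes the value `1 + j` for
the surface tension expression `J u`; the argument `x` stands for `(u, u')`. -/
noncomputable def secondDeriv (j : ℝ) (x : ℝ × ℝ) : ℝ :=
  ((1 + x.1) ^ 2 + 2 * x.2 ^ 2) / (1 + x.1) ^ 2
    - (1 + j) * (((1 + x.1) ^ 2 + x.2 ^ 2) ^ (3 / 2 : ℝ) / (1 + x.1) ^ 2)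

lemma J_eq_of_d2_eq {D : AzimuthalFlow} {u : ℝ → ℝ} {θ j : ℝ} (hu : 0 < 1 + u θ)
    (h : D.d2 u θ = secondDeriv j (u θ, D.d1 u θ)) : D.J u θ = 1 + j := by
  have hN : 0 < ((1 + u θ) ^ 2 + D.d1 u θ ^ 2) ^ (3 / 2 : ℝ) :=
    Real.rpow_pos_of_pos (by positivity) _
  rw [J, h, secondDeriv]
  field_simp
  ring

lemma secondDeriv_zero (j : ℝ) : secondDeriv j 0 = -j := by
  simp [secondDeriv]

/-- `secondDeriv` is Lipschitz in all its arguments while `1 + u` stays away from `0`. -/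
lemma exists_lipschitz_secondDeriv {η : ℝ} (hη : η < 1) (b : ℝ) :
    ∃ K : ℝ, 0 ≤ K ∧ ∀ j ∈ Icc (-b) b, ∀ j' ∈ Icc (-b) b,
      ∀ x ∈ closedBall (0 : ℝ × ℝ) η, ∀ y ∈ closedBall (0 : ℝ × ℝ) η,
        |secondDeriv j x - secondDeriv j' y| ≤ K * max |j - j'| (dist x y) := by
  have hC : ContDiffOn ℝ 1 (fun q : ℝ × (ℝ × ℝ) => secondDeriv q.1 q.2)
      (Icc (-b) b ×ˢ closedBall (0 : ℝ × ℝ) η) := by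
    intro q hq
    have h1 := (abs_le.1 (mem_closedBall_zero_prod.1 hq.2).1).1
    have h2 : 0 < 1 + q.2.1 := by linarith
    have h3 : (1 + q.2.1) ^ 2 + q.2.2 ^ 2 ≠ 0 := by positivity
    have h4 : (1 + q.2.1) ^ 2 ≠ 0 := by positivity
    refine ContDiffAt.contDiffWithinAt ?_
    unfold secondDeriv
    have hA : ContDiffAt ℝ 1 (fun q : ℝ × (ℝ × ℝ) =>
        ((1 + q.2.1) ^ 2 + 2 * q.2.2 ^ 2) / (1 + q.2.1) ^ 2) q :=
      ContDiffAt.div (by fun_prop) (by fun_prop) h4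
    have hN : ContDiffAt ℝ 1 (fun q : ℝ × (ℝ × ℝ) =>
        ((1 + q.2.1) ^ 2 + q.2.2 ^ 2) ^ (3 / 2 : ℝ)) q :=
      ContDiffAt.rpow_const_of_ne (by fun_prop) h3
    have hQ : ContDiffAt ℝ 1 (fun q : ℝ × (ℝ × ℝ) =>
        ((1 + q.2.1) ^ 2 + q.2.2 ^ 2) ^ (3 / 2 : ℝ) / (1 + q.2.1) ^ 2) q :=
      ContDiffAt.div hN (by fun_prop) h4
    exact hA.sub ((by fun_prop : ContDiffAt ℝ 1 (fun q : ℝ × (ℝ × ℝ) => 1 + q.1) q).mul hQ)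
  obtain ⟨K, hK⟩ := hC.exists_lipschitzOnWith one_ne_zero
    ((convex_Icc _ _).prod (convex_closedBall _ _))
    (isCompact_Icc.prod (isCompact_closedBall _ _))
  refine ⟨K, K.2, fun j hj j' hj' x hx y hy => ?_⟩
  have h := hK.dist_le_mul (j, x) ⟨hj, hx⟩ (j', y) ⟨hj', hy⟩
  rwa [Prod.dist_eq, Real.dist_eq, Real.dist_eq] at h

/-- A solution of the first-order system for `(u, u')` gives a profile in `X`, with the
components of the system as its one-sided derivatives. -/
lemma profile_of_system {D : AzimuthalFlow} (hε₀ : 0 < D.ε) {w : ℝ → ℝ × ℝ}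
    {φ : ℝ → ℝ × ℝ → ℝ} (hφ : ContinuousOn (fun θ => φ θ (w θ)) D.I) (hw0 : w 0 = 0)
    (hw : ∀ θ ∈ D.I, HasDerivWithinAt w ((w θ).2, φ θ (w θ)) D.I θ) :
    (fun θ => (w θ).1) ∈ D.X ∧ ∀ θ ∈ D.I, D.d1 (fun θ => (w θ).1) θ = (w θ).2 ∧
      D.d2 (fun θ => (w θ).1) θ = φ θ (w θ) := by
  have hI : UniqueDiffOn ℝ D.I := uniqueDiffOn_Icc hε₀
  have h0 : (0 : ℝ) ∈ D.I := ⟨le_rfl, hε₀.le⟩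
  have hu : ∀ θ ∈ D.I, HasDerivWithinAt (fun θ => (w θ).1) (w θ).2 D.I θ := fun θ hθ =>
    (hw θ hθ).fst
  have hv : ∀ θ ∈ D.I, HasDerivWithinAt (fun θ => (w θ).2) (φ θ (w θ)) D.I θ := fun θ hθ =>
    (hw θ hθ).snd
  have hd1 : ∀ θ ∈ D.I, D.d1 (fun θ => (w θ).1) θ = (w θ).2 := fun θ hθ =>
    (hu θ hθ).derivWithin (hI θ hθ)
  have hd1' : ∀ θ ∈ D.I, HasDerivWithinAt (D.d1 fun θ => (w θ).1) (φ θ (w θ)) D.I θ :=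
    fun θ hθ => (hv θ hθ).congr hd1 (hd1 θ hθ)
  have hd2 : ∀ θ ∈ D.I, D.d2 (fun θ => (w θ).1) θ = φ θ (w θ) := fun θ hθ =>
    (hd1' θ hθ).derivWithin (hI θ hθ)
  refine ⟨⟨?_, by simp [hw0], by rw [hd1 0 h0, hw0]; rfl⟩, fun θ hθ => ⟨hd1 θ hθ, hd2 θ hθ⟩⟩
  rw [show (2 : WithTop ℕ∞) = 1 + 1 by norm_num, contDiffOn_succ_iff_derivWithin hI]
  refine ⟨fun θ hθ => (hu θ hθ).differentiableWithinAt, by simp, ?_⟩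
  rw [show (1 : WithTop ℕ∞) = 0 + 1 by norm_num, contDiffOn_succ_iff_derivWithin hI]
  exact ⟨fun θ hθ => (hd1' θ hθ).differentiableWithinAt, by simp,
    contDiffOn_zero.2 (hφ.congr hd2)⟩

end AzimuthalFlow

open AzimuthalFlow in
theorem theorem3p2 (D : AzimuthalFlow)
    (hε₀ : 0 < D.ε) (hε₁ : D.ε < Real.pi / 2)
    (ha : 0 < D.a) (hR : 0 < D.R) (hg : 0 < D.g) (hσ : 0 < D.σ) (hPatm : 0 < D.Patm)
    (hρ : ContinuousOn (fun q : ℝ × ℝ => D.ρ q.1 q.2) (Set.Ioi 0 ×ˢ D.I))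
    (hρ_diff : ∀ r : ℝ, 0 < r → DifferentiableOn ℝ (D.ρ r) D.I)
    (hρθ : ContinuousOn (fun q : ℝ × ℝ => D.rhoTheta q.1 q.2) (Set.Ioi 0 ×ˢ D.I))
    (hF : ContinuousOn D.F (Set.Ioi 0)) :
    ∃ δ : ℝ, 0 < δ ∧ ∀ P : ℝ → ℝ, ContinuousOn P D.I →
      (∀ θ ∈ D.I, |P θ - D.P₀ θ| < δ) →
        ∃ u ∈ D.X, (∀ θ ∈ D.I, 0 < 1 + u θ) ∧ ∀ θ ∈ D.I, D.functional u P θ = 0 := by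
  set c := D.σ / (D.R * D.Patm)
  have hc : 0 < c := div_pos hσ (mul_pos hR hPatm)
  have hη : (1 / 2 : ℝ) < 1 := by norm_num
  obtain ⟨B, hB, hgap⟩ := D.exists_lipschitz_pressureGap hε₀ hε₁ hR hρ hρθ hF hη
  -- On the square `[-1/2, 1/2]²`, and with `|P - P₀| ≤ c`, the prescribed value of `J - 1` is at
  -- most `B / c + 1` in absolute value.
  obtain ⟨K, hK, hsd⟩ := exists_lipschitz_secondDeriv hη (B / c + 1)
  set L : ℝ := 1 + K * (B / c + 1)
  have hL : 0 ≤ L := by positivity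
  obtain ⟨δ, hδ, hode⟩ :=
    exists_solution_mem_closedBall_of_small hε₀.le (η := 1 / 2) (by norm_num) ⟨L, hL⟩
  refine ⟨c * min δ 1, mul_pos hc (lt_min hδ one_pos), fun P hP hsmall => ?_⟩
  set j : ℝ → ℝ → ℝ := fun θ x => (D.pressureGap θ x - (P θ - D.P₀ θ)) / c with hj
  have hjlip : ∀ θ ∈ D.I, ∀ x ∈ Icc (-(1 / 2 : ℝ)) (1 / 2), ∀ y ∈ Icc (-(1 / 2 : ℝ)) (1 / 2),
      |j θ x - j θ y| ≤ B / c * |x - y| := fun θ hθ x hx y hy => by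
    have h : j θ x - j θ y = (D.pressureGap θ x - D.pressureGap θ y) / c := by
      simp only [hj]; ring
    rw [h, abs_div, abs_of_pos hc, div_mul_eq_mul_div]
    exact div_le_div_of_nonneg_right (hgap θ hθ x hx y hy) hc.le
  have hj0 : ∀ θ ∈ D.I, |j θ 0| ≤ min δ 1 := fun θ hθ => by
    simp only [hj, pressureGap_zero, zero_sub]
    rw [abs_div, abs_neg, abs_of_pos hc, div_le_iff₀' hc]
    exact (hsmall θ hθ).le
  have hjb : ∀ θ ∈ D.I, ∀ x ∈ Icc (-(1 / 2 : ℝ)) (1 / 2),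
      j θ x ∈ Icc (-(B / c + 1)) (B / c + 1) := fun θ hθ x hx => by
    have h1 := hjlip θ hθ x hx 0 (by norm_num)
    have h2 : |x - 0| ≤ 1 := by rw [sub_zero]; exact (abs_le.2 hx).trans hη.le
    have h3 := mul_le_mul_of_nonneg_left h2 (div_nonneg hB hc.le)
    have h4 := (hj0 θ hθ).trans (min_le_right _ _)
    have h5 := abs_add_le (j θ x - j θ 0) (j θ 0)
    rw [sub_add_cancel] at h5
    exact abs_le.1 (by linarith)
  have hsq : ∀ {x : ℝ × ℝ}, x ∈ closedBall (0 : ℝ × ℝ) (1 / 2) →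
      x.1 ∈ Icc (-(1 / 2 : ℝ)) (1 / 2) := fun hx =>
    abs_le.1 (mem_closedBall_zero_prod.1 hx).1
  set φ : ℝ → ℝ × ℝ → ℝ := fun θ x => secondDeriv (j θ x.1) x with hφ
  have hφlip : ∀ θ ∈ D.I, ∀ x ∈ closedBall (0 : ℝ × ℝ) (1 / 2),
      ∀ y ∈ closedBall (0 : ℝ × ℝ) (1 / 2), |φ θ x - φ θ y| ≤ L * dist x y :=
    fun θ hθ x hx y hy => by
    have h1 := hsd _ (hjb θ hθ _ (hsq hx)) _ (hjb θ hθ _ (hsq hy)) x hx y hy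
    have h2 : |x.1 - y.1| ≤ dist x y := by
      rw [← Real.dist_eq, Prod.dist_eq]; exact le_max_left _ _
    have h3 := (hjlip θ hθ _ (hsq hx) _ (hsq hy)).trans
      (mul_le_mul_of_nonneg_left h2 (div_nonneg hB hc.le))
    have hd : 0 ≤ dist x y := dist_nonneg
    have h4 : max |j θ x.1 - j θ y.1| (dist x y) ≤ (B / c + 1) * dist x y :=
      max_le (by linarith) (by nlinarith [div_nonneg hB hc.le])
    have h5 := h1.trans (mul_le_mul_of_nonneg_left h4 hK)
    simp only [L]
    linarith
  have hjcont : ∀ x ∈ Icc (-(1 / 2 : ℝ)) (1 / 2), ContinuousOn (fun θ => j θ x) D.I :=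
    fun x hx => ((D.continuousOn_pressureGap hε₀ hε₁ hR hρ hρθ hF (by linarith [hx.1])).sub
      (hP.sub (D.continuousOn_P₀ hε₀ hε₁ ha hR hρ hρθ hF))).div_const c
  have hφcont : ∀ x ∈ closedBall (0 : ℝ × ℝ) (1 / 2), ContinuousOn (fun θ => φ θ x) D.I :=
    fun x hx => continuousOn_const.sub
      ((continuousOn_const.add (hjcont _ (hsq hx))).mul continuousOn_const)
  have hVlip : ∀ θ ∈ D.I, LipschitzOnWith ⟨L, hL⟩ (fun x : ℝ × ℝ => (x.2, φ θ x))
      (closedBall 0 (1 / 2)) := fun θ hθ => by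
    refine LipschitzOnWith.of_dist_le_mul fun x hx y hy => ?_
    rw [Prod.dist_eq]
    refine max_le ?_ (hφlip θ hθ x hx y hy)
    have h1 : dist x.2 y.2 ≤ dist x y := by rw [Prod.dist_eq (x := x)]; exact le_max_right _ _
    refine h1.trans (le_mul_of_one_le_left dist_nonneg ?_)
    exact le_add_of_nonneg_right (by positivity)
  obtain ⟨w, hw0, hw⟩ := hode (fun θ x => (x.2, φ θ x)) hVlip
    (fun x hx => continuousOn_const.prodMk (hφcont x hx)) (fun θ hθ => by
      have h : φ θ 0 = -j θ 0 := secondDeriv_zero _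
      have h' := (hj0 θ hθ).trans (min_le_left _ _)
      simpa [h, Prod.norm_def, hδ.le] using h')
  have hwc : ContinuousOn w D.I := fun θ hθ => (hw θ hθ).2.continuousWithinAt
  -- Continuity in the angle and a uniform Lipschitz bound in `x` give joint continuity.
  have hφw : ContinuousOn (fun θ => φ θ (w θ)) D.I := by
    have h := continuousOn_prod_of_continuousOn_lipschitzOnWith (Function.uncurry fun x θ => φ θ x)
      ⟨L, hL⟩ (s := closedBall (0 : ℝ × ℝ) (1 / 2)) (t := D.I) hφcont
      (fun θ hθ => LipschitzOnWith.of_dist_le_mul fun x hx y hy => hφlip θ hθ x hx y hy)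
    exact h.comp (f := fun θ => (w θ, θ)) (hwc.prodMk continuousOn_id)
      fun θ hθ => ⟨(hw θ hθ).1, hθ⟩
  obtain ⟨hX, hd⟩ := profile_of_system (D := D) hε₀ hφw hw0 fun θ hθ => (hw θ hθ).2
  have hpos : ∀ θ ∈ D.I, 0 < 1 + (w θ).1 := fun θ hθ => by
    linarith [(hsq (hw θ hθ).1).1]
  refine ⟨fun θ => (w θ).1, hX, hpos, fun θ hθ => ?_⟩
  have hJ : D.J (fun θ => (w θ).1) θ = 1 + j θ (w θ).1 :=
    J_eq_of_d2_eq (hpos θ hθ) (by rw [(hd θ hθ).1, (hd θ hθ).2])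
  rw [D.functional_eq_pressureGap hε₀ hε₁ ha hR hρ hρθ hF _ P hθ (hpos θ hθ), hJ,
    add_sub_cancel_left]
  simp only [hj]
  rw [mul_div_cancel₀ _ hc.ne']
  ring
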